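/- **Theorem (structure of the 2-nilpotent multiplier of Heisenberg algebras).** Let $K$ be a field (of arbitrary characteristic). For a Lie algebra $F$ over $K$ let $F^1=F$, $F^{c+1}=[F^c,F]$. A *Heisenberg Lie algebra* $H(m)$ is a Lie algebra $L$ over $K$ of dimension $2m+1$ with $L^2=Z(L)$ and $\dim L^2=1$. For a Lie algebra $L$, presented as $L\cong F/R$ with $F$ a free Lie algebra and $R$ an ideal of $F$, the *2-nilpotent multiplier* of $L$ is the Lie algebra $$\mathcal{M}^{(2)}(L)=(R\cap F^{3})/[[R,F],F].$$ Then, for every such presentation of $L=H(m)$: (i) if $m=1$, then $\mathcal{M}^{(2)}(H(1))$ is abelian of dimension $5$; (ii) if $m\ge 2$, then $\mathcal{M}^{(2)}(H(m))$ is abelian of dimension $\dfrac{8m^3-2m}{3}$. -/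

import Mathlib

/-- `IsHeisenberg K m L`: the `K`-Lie algebra `L` is a Heisenberg Lie algebra `H(m)`, that is,
`dim L = 2m + 1`, the derived subalgebra `L² = [L, L]` equals the centre `Z(L)`, and
`dim L² = 1`. -/
structure IsHeisenberg (K : Type*) [Field K] (m : ℕ) (L : Type*) [LieRing L] [LieAlgebra K L] :
    Prop where
  finrank_eq : Module.finrank K L = 2 * m + 1
  derived_eq_center : ⁅(⊤ : LieIdeal K L), (⊤ : LieIdeal K L)⁆ = LieAlgebra.center K L
  finrank_derived : Module.finrank K ↥⁅(⊤ : LieIdeal K L), (⊤ : LieIdeal K L)⁆ = 1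

/-- The ideal `R ∩ F^{c+1}` of `F`, where `F^{c+1} = γ_{c+1}(F)` is the `(c+1)`-st term of the
lower central series of `F` (indexed so that `F^1 = F`, which is Mathlib's term number `0`). -/
abbrev multiplierNumerator (K : Type*) [Field K] {F : Type*} [LieRing F] [LieAlgebra K F]
    (c : ℕ) (R : LieIdeal K F) : LieIdeal K F :=
  R ⊓ LieModule.lowerCentralSeries K F F c

/-- The ideal `γ_{c+1}[R, F]` of `F`, where `γ_1[R, F] = R` and `γ_{c+1}[R, F] = [γ_c[R, F], F]`. -/
def gammaBracket (K : Type*) [Field K] {F : Type*} [LieRing F] [LieAlgebra K F]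
    (R : LieIdeal K F) : ℕ → LieIdeal K F
  | 0 => R
  | c + 1 => ⁅gammaBracket K R c, (⊤ : LieIdeal K F)⁆

/-- The Lie algebra `(R ∩ F^{c+1}) / γ_{c+1}[R, F]`. When `F` is a free Lie algebra and
`L ≅ F / R`, this is the `c`-nilpotent multiplier `M^(c)(L)`. (The denominator is contained in
the numerator, so pulling it back along the inclusion loses nothing.) -/
abbrev NilpotentMultiplier (K : Type*) [Field K] {F : Type*} [LieRing F] [LieAlgebra K F]
    (c : ℕ) (R : LieIdeal K F) : Type _ :=
  ↥(multiplierNumerator K c R) ⧸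
    LieIdeal.comap (multiplierNumerator K c R).incl (gammaBracket K R c)

/-- `γ_{c+1}[R, F]` is contained in `R ∩ F^{c+1}`, so `NilpotentMultiplier` is the honest
quotient. -/
theorem gammaBracket_le_multiplierNumerator (K : Type*) [Field K] {F : Type*} [LieRing F]
    [LieAlgebra K F] (R : LieIdeal K F) (c : ℕ) :
    gammaBracket K R c ≤ multiplierNumerator K c R := by
  induction c with
  | zero => simp [gammaBracket]
  | succ c ih =>
    refine le_inf ((LieSubmodule.lie_le_left _ _).trans (ih.trans inf_le_left)) ?_
    rw [gammaBracket, LieModule.lowerCentralSeries_succ, LieSubmodule.lie_comm]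
    exact LieSubmodule.mono_lie_right _ (ih.trans inf_le_right)

/-!
# The 2-nilpotent multiplier of Heisenberg Lie algebras

Write `F^k` for the lower central series of `F` and `γ_k[R, F]` for the iterated brackets
`[[R, F], …, F]`.

*Change of presentation.* Given two free presentations of `L`, freeness yields comparison maps over
`L` in both directions, and their composites agree with the identity modulo the relations. Replacing
the entries of a `k`-fold bracket by elements congruent modulo `R` changes it by an element of
`γ_k[R, F]` (`LieHom.map_sub_mem_gammaBracket`), so the comparison maps induce mutually inverse maps
of multipliers (`NilpotentMultiplier.nonempty_equiv`). It therefore suffices to treat a minimal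
presentation, on `2m` generators lifting a basis of `L / Z(L)`; there `F³ ≤ R ≤ F²`.

*The case `m ≥ 2`.* Every centralizer in `L` is nonabelian, so for each `c` in `F` there are `a, b`
commuting with `c` modulo `R` such that `[a, b]` spans `F²` modulo `R`. The Jacobi identity then puts
`[c, [a, b]]` in `[R, F]`, whence `F³ ≤ [R, F]` and `[[R, F], F] = F⁴`. The multiplier is `F³ / F⁴`,
the degree three part of a free Lie algebra on `n = 2m` generators, of dimension `(n³ - n) / 3`.

*The case `m = 1`.* Here `R = F³` and the multiplier is `F³ / F⁵`, of dimension `2 + 3`.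

*Dimensions of the graded pieces.* Basic commutators span by the Jacobi identity. They are
independent because there is a dual family of functionals, namely signed coefficients of words in the
free associative algebra. The words are chosen so that these coefficients are `±1`, which makes the
argument valid in every characteristic. The coefficient of a word of length `d` is realised as the
corner entry of a representation by strictly upper triangular matrices of size `d + 1`, which makes
its vanishing on `F^{d+1}` evident (`FreeLieAlgebra.wordCoeff_eq_zero`).

*Commutativity* holds for every presentation, as
`[R ∩ F^{c+1}, R ∩ F^{c+1}] ≤ [F^{c+1}, R] ≤ γ_{c+2}[R, F]`.
-/

/-! ### Brackets with the terms of the lower central series -/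

section Bracket

variable {K : Type*} [Field K] {F : Type*} [LieRing F] [LieAlgebra K F]

/-- The three subgroups lemma for ideals, in the form of the Jacobi identity. -/
theorem LieIdeal.lie_lie_le_of_le {I J N P : LieIdeal K F} (h₁ : ⁅I, ⁅J, N⁆⁆ ≤ P)
    (h₂ : ⁅J, ⁅I, N⁆⁆ ≤ P) : ⁅⁅I, J⁆, N⁆ ≤ P := by
  rw [LieSubmodule.lie_le_iff]
  intro x hx n hn
  rw [← LieSubmodule.mem_toSubmodule, LieSubmodule.lieIdeal_oper_eq_linear_span'] at hx
  induction hx using Submodule.span_induction with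
  | mem x hx =>
    obtain ⟨a, ha, b, hb, rfl⟩ := hx
    rw [lie_lie]
    exact sub_mem (h₁ (LieSubmodule.lie_mem_lie ha (LieSubmodule.lie_mem_lie hb hn)))
      (h₂ (LieSubmodule.lie_mem_lie hb (LieSubmodule.lie_mem_lie ha hn)))
  | zero => simp
  | add x y _ _ hx hy => rw [add_lie]; exact add_mem hx hy
  | smul t x _ hx => rw [smul_lie]; exact P.smul_mem t hx

theorem lie_mem_gammaBracket_succ {R : LieIdeal K F} {k : ℕ} {x : F}
    (hx : x ∈ gammaBracket K R k) (y : F) : ⁅x, y⁆ ∈ gammaBracket K R (k + 1) :=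
  LieSubmodule.lie_mem_lie hx (LieSubmodule.mem_top y)

theorem lie_mem_gammaBracket_succ' {R : LieIdeal K F} {k : ℕ} {x : F}
    (hx : x ∈ gammaBracket K R k) (y : F) : ⁅y, x⁆ ∈ gammaBracket K R (k + 1) := by
  rw [← lie_skew]
  exact neg_mem (lie_mem_gammaBracket_succ hx y)

theorem lowerCentralSeries_lie_gammaBracket_le (R : LieIdeal K F) (j k : ℕ) :
    ⁅LieModule.lowerCentralSeries K F F j, gammaBracket K R k⁆ ≤ gammaBracket K R (j + k + 1) := by
  induction j generalizing k with
  | zero => rw [LieModule.lowerCentralSeries_zero, LieSubmodule.lie_comm, zero_add]; rfl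
  | succ j ih =>
    rw [LieModule.lowerCentralSeries_succ]
    apply LieIdeal.lie_lie_le_of_le
    · refine (LieSubmodule.mono_lie_right _ (ih k)).trans ?_
      rw [LieSubmodule.lie_comm, show j + 1 + k + 1 = j + k + 1 + 1 by ring]
      rfl
    · rw [LieSubmodule.lie_comm (⊤ : LieIdeal K F)]
      refine (ih (k + 1)).trans ?_
      rw [show j + 1 + k + 1 = j + (k + 1) + 1 by ring]

theorem gammaBracket_top (k : ℕ) :
    gammaBracket K (⊤ : LieIdeal K F) k = LieModule.lowerCentralSeries K F F k := by
  induction k with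
  | zero => rfl
  | succ k ih =>
    rw [gammaBracket, ih, LieSubmodule.lie_comm, LieModule.lowerCentralSeries_succ]

theorem gammaBracket_mono {R S : LieIdeal K F} (h : R ≤ S) (k : ℕ) :
    gammaBracket K R k ≤ gammaBracket K S k := by
  induction k with
  | zero => exact h
  | succ k ih => exact LieSubmodule.mono_lie_left _ ih

theorem gammaBracket_lowerCentralSeries (j k : ℕ) :
    gammaBracket K (LieModule.lowerCentralSeries K F F j) k =
      LieModule.lowerCentralSeries K F F (j + k) := by
  induction k with
  | zero => rfl
  | succ k ih =>
    rw [gammaBracket, ih, LieSubmodule.lie_comm, ← add_assoc, LieModule.lowerCentralSeries_succ]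

theorem lie_mem_lowerCentralSeries {i j : ℕ} {x y : F}
    (hx : x ∈ LieModule.lowerCentralSeries K F F i)
    (hy : y ∈ LieModule.lowerCentralSeries K F F j) :
    ⁅x, y⁆ ∈ LieModule.lowerCentralSeries K F F (i + j + 1) := by
  rw [← gammaBracket_top] at hy ⊢
  exact lowerCentralSeries_lie_gammaBracket_le _ i j (LieSubmodule.lie_mem_lie hx hy)

variable {F' : Type*} [LieRing F'] [LieAlgebra K F']

theorem LieHom.map_mem_gammaBracket (f : F →ₗ⁅K⁆ F') {R : LieIdeal K F} {R' : LieIdeal K F'}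
    (h : ∀ x ∈ R, f x ∈ R') (k : ℕ) {x : F} (hx : x ∈ gammaBracket K R k) :
    f x ∈ gammaBracket K R' k := by
  suffices gammaBracket K R k ≤ (gammaBracket K R' k).comap f from LieIdeal.mem_comap.1 (this hx)
  clear hx
  induction k with
  | zero => exact fun y hy => LieIdeal.mem_comap.2 (h y hy)
  | succ k ih =>
    rw [gammaBracket, LieSubmodule.lie_le_iff]
    intro x hx y _
    rw [LieIdeal.mem_comap, LieHom.map_lie]
    exact lie_mem_gammaBracket_succ (LieIdeal.mem_comap.1 (ih hx)) _

theorem LieHom.map_mem_lowerCentralSeries (f : F →ₗ⁅K⁆ F') (k : ℕ) {x : F}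
    (hx : x ∈ LieModule.lowerCentralSeries K F F k) :
    f x ∈ LieModule.lowerCentralSeries K F' F' k := by
  rw [← gammaBracket_top] at hx ⊢
  exact f.map_mem_gammaBracket (fun _ _ => LieSubmodule.mem_top _) k hx

/-- Replacing entries of a `(k + 1)`-fold bracket by elements congruent to them modulo `R` changes
the bracket by an element of `γ_{k+1}[R, F]`. -/
theorem LieHom.map_sub_mem_gammaBracket (f : F →ₗ⁅K⁆ F) {R : LieIdeal K F}
    (h : ∀ x, f x - x ∈ R) (k : ℕ) {x : F} (hx : x ∈ LieModule.lowerCentralSeries K F F k) :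
    f x - x ∈ gammaBracket K R k := by
  induction k generalizing x with
  | zero => exact h x
  | succ k ih =>
    rw [LieModule.lowerCentralSeries_succ, ← LieSubmodule.mem_toSubmodule,
      LieSubmodule.lieIdeal_oper_eq_linear_span'] at hx
    induction hx using Submodule.span_induction with
    | mem x hx =>
      obtain ⟨a, -, b, hb, rfl⟩ := hx
      have e : f ⁅a, b⁆ - ⁅a, b⁆ = ⁅f a, f b - b⁆ - ⁅b, f a - a⁆ := by
        rw [LieHom.map_lie, lie_sub, lie_sub, ← lie_skew a b, ← lie_skew (f a) b]; abel
      rw [e]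
      refine sub_mem (lie_mem_gammaBracket_succ' (ih hb) _) ?_
      exact lowerCentralSeries_lie_gammaBracket_le R k 0 (LieSubmodule.lie_mem_lie hb (h a))
    | zero => simp
    | add x y _ _ hx hy => rw [map_add, add_sub_add_comm]; exact add_mem hx hy
    | smul t x _ hx => rw [map_smul, ← smul_sub]; exact (gammaBracket K R (k + 1)).smul_mem t hx

end Bracket

/-! ### Subquotients of vector spaces -/

section Subquotient

variable {K : Type*} [Field K] {E E' : Type*} [AddCommGroup E] [Module K E]
  [AddCommGroup E'] [Module K E']

/-- Linear maps that are mutually inverse modulo the denominators identify two subquotients. -/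
theorem Submodule.nonempty_subquotient_equiv {A B : Submodule K E} {A' B' : Submodule K E'}
    (f : E →ₗ[K] E') (g : E' →ₗ[K] E) (hfA : ∀ x ∈ A, f x ∈ A') (hfB : ∀ x ∈ B, f x ∈ B')
    (hgA : ∀ x ∈ A', g x ∈ A) (hgB : ∀ x ∈ B', g x ∈ B)
    (hgf : ∀ x ∈ A, g (f x) - x ∈ B) (hfg : ∀ x ∈ A', f (g x) - x ∈ B') :
    Nonempty ((A ⧸ B.comap A.subtype) ≃ₗ[K] (A' ⧸ B'.comap A'.subtype)) := by
  refine ⟨LinearEquiv.ofLinearMap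
    (Submodule.mapQ _ _ (f.restrict hfA) fun x hx => hfB _ hx)
    (Submodule.mapQ _ _ (g.restrict hgA) fun x hx => hgB _ hx) ?_ ?_⟩
  · ext x
    exact (Submodule.Quotient.eq _).2 (hfg x x.2)
  · ext x
    exact (Submodule.Quotient.eq _).2 (hgf x x.2)

/-- A family spanning `A` modulo `B` and admitting a dual family of functionals that vanish on `B`
is a basis of `A / B`. -/
theorem Submodule.finrank_subquotient_of_dual {ι : Type*} [Fintype ι] [DecidableEq ι]
    {A B : Submodule K E} (b : ι → E) (φ : ι → E →ₗ[K] K) (hb : ∀ i, b i ∈ A)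
    (hA : A ≤ Submodule.span K (Set.range b) ⊔ B) (hφB : ∀ i, ∀ x ∈ B, φ i x = 0)
    (hφ : ∀ i j, φ i (b j) = if i = j then 1 else 0) :
    Module.Finite K (A ⧸ B.comap A.subtype) ∧
      Module.finrank K (A ⧸ B.comap A.subtype) = Fintype.card ι := by
  let Φ : A →ₗ[K] ι → K := (LinearMap.pi φ).comp A.subtype
  have hsum : ∀ (c : ι → K) i, φ i (∑ j, c j • b j) = c i := by
    intro c i
    simp [hφ]
  have hsurj : Function.Surjective Φ := fun c =>
    ⟨⟨∑ j, c j • b j, sum_mem fun j _ => A.smul_mem _ (hb j)⟩, funext fun i => hsum c i⟩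
  have hker : B.comap A.subtype = LinearMap.ker Φ := by
    ext ⟨x, hx⟩
    simp only [Submodule.mem_comap, Submodule.subtype_apply, LinearMap.mem_ker]
    constructor
    · exact fun h => funext fun i => hφB i x h
    · intro h
      obtain ⟨y, hy, z, hz, rfl⟩ := Submodule.mem_sup.1 (hA hx)
      obtain ⟨c, rfl⟩ := (Submodule.mem_span_range_iff_exists_fun K).1 hy
      have hc : c = 0 := by
        funext i
        have := congrFun h i
        simpa [Φ, hsum, hφB i z hz, -map_sum] using this
      simpa [hc] using hz
  let e : (A ⧸ B.comap A.subtype) ≃ₗ[K] (ι → K) :=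
    (Submodule.quotEquivOfEq _ _ hker).trans (Φ.quotKerEquivOfSurjective hsurj)
  exact ⟨Module.Finite.equiv e.symm, by rw [e.finrank_eq, Module.finrank_fintype_fun_eq_card]⟩

end Subquotient

/-! ### Independence of the presentation -/

section Invariance

variable {K : Type*} [Field K]

/-- The nilpotent multiplier as a subquotient of vector spaces. -/
def NilpotentMultiplier.linearEquivSubquotient {F : Type*} [LieRing F] [LieAlgebra K F] (c : ℕ)
    (R : LieIdeal K F) :
    NilpotentMultiplier K c R ≃ₗ[K]
      ((multiplierNumerator K c R).toSubmodule ⧸ (gammaBracket K R c).toSubmodule.comap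
        (multiplierNumerator K c R).toSubmodule.subtype) :=
  LinearEquiv.refl K _

theorem FreeLieAlgebra.exists_comp_eq {X F L : Type*} [LieRing F] [LieAlgebra K F] [LieRing L]
    [LieAlgebra K L] (ρ : FreeLieAlgebra K X →ₗ⁅K⁆ L) (π : F →ₗ⁅K⁆ L)
    (hπ : Function.Surjective π) : ∃ f : FreeLieAlgebra K X →ₗ⁅K⁆ F, ∀ x, π (f x) = ρ x := by
  choose s hs using hπ
  refine ⟨FreeLieAlgebra.lift K fun x => s (ρ (FreeLieAlgebra.of K x)), fun x => ?_⟩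
  rw [← LieHom.comp_apply]
  congr 1
  ext x
  simp [hs]

/-- The nilpotent multipliers computed from two free presentations of `L` are isomorphic: the
comparison maps between the presentations are mutually inverse modulo the relations. -/
theorem NilpotentMultiplier.nonempty_equiv {L : Type*} [LieRing L] [LieAlgebra K L] (c : ℕ)
    {X Y : Type*} (π : FreeLieAlgebra K X →ₗ⁅K⁆ L) (hπ : Function.Surjective π)
    (ρ : FreeLieAlgebra K Y →ₗ⁅K⁆ L) (hρ : Function.Surjective ρ) :
    Nonempty (NilpotentMultiplier K c π.ker ≃ₗ[K] NilpotentMultiplier K c ρ.ker) := by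
  obtain ⟨f, hf⟩ := FreeLieAlgebra.exists_comp_eq π ρ hρ
  obtain ⟨g, hg⟩ := FreeLieAlgebra.exists_comp_eq ρ π hπ
  have hfR : ∀ x ∈ π.ker, f x ∈ ρ.ker := fun x hx => by
    rw [LieHom.mem_ker] at hx ⊢; rw [hf, hx]
  have hgR : ∀ x ∈ ρ.ker, g x ∈ π.ker := fun x hx => by
    rw [LieHom.mem_ker] at hx ⊢; rw [hg, hx]
  have hgf : ∀ x, g.comp f x - x ∈ π.ker := fun x => by simp [hf, hg]
  have hfg : ∀ x, f.comp g x - x ∈ ρ.ker := fun x => by simp [hf, hg]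
  obtain ⟨e⟩ := Submodule.nonempty_subquotient_equiv
    (A := (multiplierNumerator K c π.ker).toSubmodule)
    (B := (gammaBracket K π.ker c).toSubmodule)
    (A' := (multiplierNumerator K c ρ.ker).toSubmodule)
    (B' := (gammaBracket K ρ.ker c).toSubmodule) f.toLinearMap g.toLinearMap
    (fun x hx => ⟨hfR x hx.1, f.map_mem_lowerCentralSeries c hx.2⟩)
    (fun x hx => f.map_mem_gammaBracket hfR c hx)
    (fun x hx => ⟨hgR x hx.1, g.map_mem_lowerCentralSeries c hx.2⟩)
    (fun x hx => g.map_mem_gammaBracket hgR c hx)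
    (fun x hx => (g.comp f).map_sub_mem_gammaBracket hgf c hx.2)
    (fun x hx => (f.comp g).map_sub_mem_gammaBracket hfg c hx.2)
  exact ⟨(linearEquivSubquotient c _).trans (e.trans (linearEquivSubquotient c _).symm)⟩

/-- `[R ∩ F^{c+1}, R ∩ F^{c+1}] ≤ [F^{c+1}, R] ≤ γ_{c+2}[R, F]`. -/
theorem NilpotentMultiplier.isLieAbelian {F : Type*} [LieRing F] [LieAlgebra K F] (c : ℕ)
    (R : LieIdeal K F) : IsLieAbelian (NilpotentMultiplier K c R) := by
  refine ⟨fun x y => ?_⟩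
  induction x using Quotient.inductionOn' with | _ x
  induction y using Quotient.inductionOn' with | _ y
  change LieSubmodule.Quotient.mk ⁅x, y⁆ = _
  rw [LieSubmodule.Quotient.mk_eq_zero', LieIdeal.mem_comap]
  have h : ⁅(x : F), (y : F)⁆ ∈ gammaBracket K R (c + 1) :=
    lowerCentralSeries_lie_gammaBracket_le R c 0 (LieSubmodule.lie_mem_lie x.2.2 y.2.1)
  exact LieSubmodule.lie_le_left _ _ h

end Invariance

/-! ### Spanning sets for the graded pieces of a free Lie algebra -/

section Spanning

variable {K : Type*} [Field K] {X : Type*}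

namespace FreeLieAlgebra

theorem mem_lieSubalgebra_of_forall_of_mem (S : LieSubalgebra K (FreeLieAlgebra K X))
    (h : ∀ x, of K x ∈ S) (y : FreeLieAlgebra K X) : y ∈ S := by
  have e : S.incl.comp (lift K fun x => (⟨of K x, h x⟩ : S)) = LieHom.id := by
    ext x
    simp
  have := LieHom.congr_fun e y
  rw [LieHom.comp_apply, LieHom.id_apply] at this
  rw [← this]
  exact Subtype.property _

/-- A free Lie algebra on `X` is spanned by `X` modulo its derived subalgebra. -/
theorem mem_span_of_sup_derived (y : FreeLieAlgebra K X) :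
    y ∈ Submodule.span K (Set.range (of K)) ⊔
      (LieModule.lowerCentralSeries K (FreeLieAlgebra K X) (FreeLieAlgebra K X) 1).toSubmodule := by
  let S : LieSubalgebra K (FreeLieAlgebra K X) :=
    { Submodule.span K (Set.range (of K)) ⊔ (LieModule.lowerCentralSeries K (FreeLieAlgebra K X)
        (FreeLieAlgebra K X) 1).toSubmodule with
      lie_mem' := fun {x y} _ _ => Submodule.mem_sup_right
        (lie_mem_lowerCentralSeries (i := 0) (j := 0) (LieSubmodule.mem_top x)
          (LieSubmodule.mem_top y)) }
  exact mem_lieSubalgebra_of_forall_of_mem S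
    (fun x => Submodule.mem_sup_left (Submodule.subset_span ⟨x, rfl⟩)) y

/-- If `T` spans `F^{k+1}` modulo `F^{k+2}`, then the brackets of the generators with `T` span
`F^{k+2}` modulo `F^{k+3}`. -/
theorem lowerCentralSeries_succ_le_span_sup {k : ℕ} {T : Set (FreeLieAlgebra K X)}
    {U : Submodule K (FreeLieAlgebra K X)}
    (hT : (LieModule.lowerCentralSeries K (FreeLieAlgebra K X) (FreeLieAlgebra K X) k).toSubmodule ≤
      Submodule.span K T ⊔ (LieModule.lowerCentralSeries K (FreeLieAlgebra K X)
        (FreeLieAlgebra K X) (k + 1)).toSubmodule)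
    (hU : ∀ x : X, ∀ t ∈ T, ⁅of K x, t⁆ ∈ U ⊔ (LieModule.lowerCentralSeries K (FreeLieAlgebra K X)
        (FreeLieAlgebra K X) (k + 2)).toSubmodule) :
    (LieModule.lowerCentralSeries K (FreeLieAlgebra K X) (FreeLieAlgebra K X)
        (k + 1)).toSubmodule ≤
      U ⊔ (LieModule.lowerCentralSeries K (FreeLieAlgebra K X) (FreeLieAlgebra K X)
        (k + 2)).toSubmodule := by
  set P := U ⊔ (LieModule.lowerCentralSeries K (FreeLieAlgebra K X) (FreeLieAlgebra K X)
    (k + 2)).toSubmodule with hP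
  rw [LieModule.lowerCentralSeries_succ, LieSubmodule.lieIdeal_oper_eq_linear_span',
    Submodule.span_le]
  rintro _ ⟨x, -, n, hn, rfl⟩
  obtain ⟨u, hu, x', hx', rfl⟩ := Submodule.mem_sup.1 (mem_span_of_sup_derived x)
  obtain ⟨t, ht, n', hn', rfl⟩ := Submodule.mem_sup.1 (hT hn)
  have h₁ : ⁅x', t + n'⁆ ∈ P := Submodule.mem_sup_right <| by
    have := lie_mem_lowerCentralSeries hx' hn
    rwa [show 1 + k + 1 = k + 2 by ring] at this
  have h₂ : ⁅u, n'⁆ ∈ P := Submodule.mem_sup_right <| by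
    have := lie_mem_lowerCentralSeries (i := 0) (LieSubmodule.mem_top u) hn'
    rwa [show 0 + (k + 1) + 1 = k + 2 by ring] at this
  have h₃ : ⁅u, t⁆ ∈ P := by
    clear hn h₁ h₂
    induction hu, ht using Submodule.span_induction₂ with
    | mem_mem u t hu ht =>
      obtain ⟨x, rfl⟩ := hu
      exact hU x t ht
    | zero_left => simp
    | zero_right => simp
    | add_left _ _ _ _ _ _ h h' => rw [add_lie]; exact add_mem h h'
    | add_right _ _ _ _ _ _ h h' => rw [lie_add]; exact add_mem h h'
    | smul_left r _ _ _ _ h => rw [smul_lie]; exact P.smul_mem r h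
    | smul_right r _ _ _ _ h => rw [lie_smul]; exact P.smul_mem r h
  rw [SetLike.mem_coe, add_lie, lie_add]
  exact add_mem (add_mem h₃ h₂) h₁

variable [LinearOrder X]

theorem derived_le_span_sup :
    (LieModule.lowerCentralSeries K (FreeLieAlgebra K X) (FreeLieAlgebra K X) 1).toSubmodule ≤
      Submodule.span K {t | ∃ i j, i < j ∧ t = ⁅of K i, of K j⁆} ⊔
        (LieModule.lowerCentralSeries K (FreeLieAlgebra K X)
          (FreeLieAlgebra K X) 2).toSubmodule := by
  refine lowerCentralSeries_succ_le_span_sup (k := 0) (T := Set.range (of K))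
    (fun y _ => mem_span_of_sup_derived y) ?_
  rintro i _ ⟨j, rfl⟩
  apply Submodule.mem_sup_left
  rcases lt_trichotomy i j with h | rfl | h
  · exact Submodule.subset_span ⟨i, j, h, rfl⟩
  · rw [lie_self]; exact zero_mem _
  · rw [← lie_skew]
    exact neg_mem (Submodule.subset_span ⟨j, i, h, rfl⟩)

/-- The index set of the basic commutators `[[x_i, x_j], x_k]` of weight three: the triples with
`i < j` and `i ≤ k`. -/
abbrev BasicTriple (X : Type*) [LinearOrder X] : Type _ :=
  {p : X × X × X // p.1 < p.2.1 ∧ p.1 ≤ p.2.2}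

variable (K) in
/-- The basic commutator `[[x_i, x_j], x_k]`. -/
noncomputable def basicCommutator (p : BasicTriple X) : FreeLieAlgebra K X :=
  ⁅⁅of K p.1.1, of K p.1.2.1⁆, of K p.1.2.2⁆

/-- The basic commutators of weight three span `F³` modulo `F⁴`: for `k < i < j` the Jacobi identity
rewrites `[[x_i, x_j], x_k]` as `[[x_k, x_j], x_i] - [[x_k, x_i], x_j]`. -/
theorem lowerCentralSeries_two_le_span_sup :
    (LieModule.lowerCentralSeries K (FreeLieAlgebra K X) (FreeLieAlgebra K X) 2).toSubmodule ≤
      Submodule.span K (Set.range (basicCommutator K (X := X))) ⊔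
        (LieModule.lowerCentralSeries K (FreeLieAlgebra K X)
          (FreeLieAlgebra K X) 3).toSubmodule := by
  refine lowerCentralSeries_succ_le_span_sup (k := 1) derived_le_span_sup ?_
  rintro k _ ⟨i, j, hij, rfl⟩
  apply Submodule.mem_sup_left
  rcases le_or_gt i k with h | h
  · rw [← lie_skew]
    exact neg_mem (Submodule.subset_span ⟨⟨(i, j, k), hij, h⟩, rfl⟩)
  · have e : ⁅of K k, ⁅of K i, of K j⁆⁆ =
        ⁅⁅of K k, of K i⁆, of K j⁆ - ⁅⁅of K k, of K j⁆, of K i⁆ := by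
      rw [leibniz_lie, ← lie_skew (of K i) ⁅of K k, of K j⁆, sub_eq_add_neg]
    rw [e]
    exact sub_mem (Submodule.subset_span ⟨⟨(k, i, j), h, (h.trans hij).le⟩, rfl⟩)
      (Submodule.subset_span ⟨⟨(k, j, i), h.trans hij, h.le⟩, rfl⟩)

theorem basicCommutator_mem (p : BasicTriple X) : basicCommutator K p ∈
    LieModule.lowerCentralSeries K (FreeLieAlgebra K X) (FreeLieAlgebra K X) 2 :=
  lie_mem_lowerCentralSeries (i := 1) (j := 0)
    (lie_mem_lowerCentralSeries (i := 0) (j := 0) (LieSubmodule.mem_top _) (LieSubmodule.mem_top _))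
    (LieSubmodule.mem_top _)

end FreeLieAlgebra

theorem three_mul_card_basicTriple (n : ℕ) :
    3 * Fintype.card (FreeLieAlgebra.BasicTriple (Fin n)) + n = n ^ 3 := by
  have h : Fintype.card (FreeLieAlgebra.BasicTriple (Fin n)) =
      ∑ i : Fin n, (n - 1 - i) * (n - i) := by
    rw [Fintype.card_subtype, Finset.card_filter, Fintype.sum_prod_type]
    refine Finset.sum_congr rfl fun i _ => ?_
    rw [Fintype.sum_prod_type, ← Fin.card_Ioi, ← Fin.card_Ici, ← Finset.filter_lt_eq_Ioi,
      ← Finset.filter_le_eq_Ici, Finset.card_filter, Finset.card_filter, Finset.sum_mul_sum]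
    refine Finset.sum_congr rfl fun j _ => Finset.sum_congr rfl fun k _ => ?_
    by_cases h₁ : i < j <;> by_cases h₂ : i ≤ k <;> simp [h₁, h₂]
  have h' : ∀ n : ℕ, 3 * ∑ i ∈ Finset.range n, i * (i + 1) + n = n ^ 3 := by
    intro n
    induction n with
    | zero => simp
    | succ n ih => rw [Finset.sum_range_succ]; linear_combination ih
  rw [h, Fin.sum_univ_eq_sum_range (fun i => (n - 1 - i) * (n - i)), ← h' n,
    ← Finset.sum_range_reflect (fun i => i * (i + 1))]
  congr 2
  refine Finset.sum_congr rfl fun i hi => ?_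
  have := Finset.mem_range.1 hi
  congr 1
  omega

end Spanning

/-! ### Coefficients of words -/

section Word

attribute [local instance] LieRing.ofAssociativeRing

variable {K : Type*} [Field K] {X : Type*} [DecidableEq X]

namespace FreeLieAlgebra

variable (K) in
/-- The matrix whose only nonzero entries are `1` in position `(p, p + 1)` whenever the `p`-th letter
of `w` is `x`. The corner entry of a product of `d` such matrices is `1` if their letters spell the
first `d` letters of `w`, and `0` otherwise. -/
def wordMatrix (d : ℕ) (w : List X) (x : X) : Matrix (Fin (d + 1)) (Fin (d + 1)) K :=
  Matrix.of fun p q => if (p : ℕ) + 1 = q ∧ w[(p : ℕ)]? = some x then 1 else 0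

variable (K) in
/-- The representation of the free Lie algebra by strictly upper triangular matrices that extends
`wordMatrix`. -/
noncomputable def wordRep (d : ℕ) (w : List X) :
    FreeLieAlgebra K X →ₗ⁅K⁆ Matrix (Fin (d + 1)) (Fin (d + 1)) K :=
  lift K (wordMatrix K d w)

variable (K) in
/-- The coefficient of the word `w` of length `d` in a Lie polynomial, expanded in the free
associative algebra; it is read off as the corner entry of `wordRep`. -/
noncomputable def wordCoeff (d : ℕ) (w : List X) : FreeLieAlgebra K X →ₗ[K] K :=
  (Matrix.entryLinearMap K K 0 (Fin.last d)).comp (wordRep K d w).toLinearMap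

theorem wordCoeff_apply (d : ℕ) (w : List X) (y : FreeLieAlgebra K X) :
    wordCoeff K d w y = wordRep K d w y 0 (Fin.last d) := rfl

/-- Words occurring in elements of `F^{k+1}` have at least `k + 1` letters. -/
theorem wordRep_apply_eq_zero (d : ℕ) (w : List X) (k : ℕ) {y : FreeLieAlgebra K X}
    (hy : y ∈ LieModule.lowerCentralSeries K (FreeLieAlgebra K X) (FreeLieAlgebra K X) k)
    {p q : Fin (d + 1)} (hpq : (q : ℕ) ≤ p + k) : wordRep K d w y p q = 0 := by
  -- A product vanishes in the required positions when its factors do.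
  have key : ∀ (a b : ℕ) (M N : Matrix (Fin (d + 1)) (Fin (d + 1)) K),
      (∀ p q : Fin (d + 1), (q : ℕ) ≤ p + a → M p q = 0) →
      (∀ p q : Fin (d + 1), (q : ℕ) ≤ p + b → N p q = 0) →
      ∀ p q : Fin (d + 1), (q : ℕ) ≤ p + (a + b + 1) → (M * N) p q = 0 := by
    intro a b M N hM hN p q hpq
    rw [Matrix.mul_apply]
    refine Finset.sum_eq_zero fun r _ => ?_
    rcases le_or_gt (r : ℕ) (p + a) with h | h
    · rw [hM p r h, zero_mul]
    · rw [hN r q (by omega), mul_zero]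
  have base : ∀ (y : FreeLieAlgebra K X) (p q : Fin (d + 1)), (q : ℕ) ≤ p + 0 →
      wordRep K d w y p q = 0 := by
    intro y
    let S : LieSubalgebra K (FreeLieAlgebra K X) :=
      { carrier := {y | ∀ p q : Fin (d + 1), (q : ℕ) ≤ p + 0 → wordRep K d w y p q = 0}
        add_mem' := fun {x y} hx hy p q h => by simp [hx p q h, hy p q h]
        zero_mem' := fun p q _ => by simp
        smul_mem' := fun c x hx p q h => by simp [hx p q h]
        lie_mem' := fun {x y} hx hy p q h => by
          rw [LieHom.map_lie, LieRing.of_associative_ring_bracket, Matrix.sub_apply,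
            key 0 0 _ _ hx hy p q (by omega), key 0 0 _ _ hy hx p q (by omega), sub_zero] }
    refine mem_lieSubalgebra_of_forall_of_mem S (fun x p q h => ?_) y
    rw [wordRep, lift_of_apply, wordMatrix, Matrix.of_apply, if_neg]
    omega
  induction k generalizing y p q with
  | zero => exact base y p q hpq
  | succ k ih =>
    rw [LieModule.lowerCentralSeries_succ, ← LieSubmodule.mem_toSubmodule,
      LieSubmodule.lieIdeal_oper_eq_linear_span'] at hy
    induction hy using Submodule.span_induction with
    | mem y hy =>
      obtain ⟨a, -, b, hb, rfl⟩ := hy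
      rw [LieHom.map_lie, LieRing.of_associative_ring_bracket, Matrix.sub_apply,
        key 0 k _ _ (base a) (fun p q h => ih hb h) p q (by omega),
        key k 0 _ _ (fun p q h => ih hb h) (base a) p q (by omega), sub_zero]
    | zero => simp
    | add x y _ _ hx hy => simp [hx, hy]
    | smul c x _ hx => simp [hx]

theorem wordCoeff_eq_zero {d k : ℕ} (h : d ≤ k) (w : List X) {y : FreeLieAlgebra K X}
    (hy : y ∈ LieModule.lowerCentralSeries K (FreeLieAlgebra K X) (FreeLieAlgebra K X) k) :
    wordCoeff K d w y = 0 :=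
  wordRep_apply_eq_zero d w k hy (by simpa using h)

theorem wordMatrix_mul_mul_apply (w : List X) (a b c : X) :
    (wordMatrix K 3 w a * wordMatrix K 3 w b * wordMatrix K 3 w c) 0 (Fin.last 3) =
      if w[0]? = some a ∧ w[1]? = some b ∧ w[2]? = some c then 1 else 0 := by
  simp only [Matrix.mul_apply, Fin.sum_univ_succ, wordMatrix]
  simp [ite_and]
  split_ifs <;> rfl

theorem wordMatrix_mul_mul_mul_apply (w : List X) (a b c e : X) :
    (wordMatrix K 4 w a * wordMatrix K 4 w b * wordMatrix K 4 w c * wordMatrix K 4 w e) 0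
        (Fin.last 4) =
      if w[0]? = some a ∧ w[1]? = some b ∧ w[2]? = some c ∧ w[3]? = some e then 1 else 0 := by
  simp only [Matrix.mul_apply, Fin.sum_univ_succ, wordMatrix]
  simp [ite_and]
  split_ifs <;> rfl

theorem wordCoeff_three_lie_lie (w : List X) (a b c : X) :
    wordCoeff K 3 w ⁅⁅of K a, of K b⁆, of K c⁆ =
      (if w[0]? = some a ∧ w[1]? = some b ∧ w[2]? = some c then 1 else 0) -
      (if w[0]? = some b ∧ w[1]? = some a ∧ w[2]? = some c then 1 else 0) -
      (if w[0]? = some c ∧ w[1]? = some a ∧ w[2]? = some b then 1 else 0) +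
      (if w[0]? = some c ∧ w[1]? = some b ∧ w[2]? = some a then 1 else 0) := by
  simp only [← wordMatrix_mul_mul_apply]
  simp only [wordCoeff_apply, wordRep, LieHom.map_lie, lift_of_apply,
    LieRing.of_associative_ring_bracket, sub_mul, mul_sub, Matrix.sub_apply, ← mul_assoc]
  ring

/-- The functional dual to the basic commutator `[[x_i, x_j], x_k]`. When `k = i` the coefficient of
`x_i x_i x_j` is used, since that of `x_i x_j x_i` is `2`, which may vanish in `K`. -/
noncomputable def basicDual [LinearOrder X] (p : BasicTriple X) : FreeLieAlgebra K X →ₗ[K] K :=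
  if p.1.1 < p.1.2.2 then wordCoeff K 3 [p.1.1, p.1.2.1, p.1.2.2]
  else -wordCoeff K 3 [p.1.1, p.1.1, p.1.2.1]

end FreeLieAlgebra

end Word

section Dual

variable {K : Type*} [Field K] {X : Type*} [LinearOrder X]

namespace FreeLieAlgebra

/-- A word `x_i x_j x_k` with `i < j`, `i < k` occurs in no other basic commutator, since apart from
`x_a x_b x_c` itself no word of `[[x_a, x_b], x_c]` starts with a strictly smallest letter. -/
theorem basicDual_basicCommutator (p q : BasicTriple X) :
    basicDual p (basicCommutator K q) = if p = q then 1 else 0 := by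
  obtain ⟨⟨i, j, k⟩, hij, hik⟩ := p
  obtain ⟨⟨a, b, c⟩, hab, hac⟩ := q
  simp only at hij hik hab hac
  unfold basicDual basicCommutator
  by_cases h : i < k
  · simp only [if_pos h, wordCoeff_three_lie_lie, Subtype.mk.injEq, Prod.mk.injEq]
    rw [if_neg (c := _ = some b ∧ _), if_neg (c := _ = some c ∧ _), if_neg (c := _ = some c ∧ _)]
    · simp
    all_goals
      simp
      grind
  · obtain rfl : i = k := le_antisymm hik (not_lt.1 h)
    simp only [if_neg h, LinearMap.neg_apply, wordCoeff_three_lie_lie, Subtype.mk.injEq,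
      Prod.mk.injEq]
    simp
    grind

end FreeLieAlgebra

end Dual

/-! ### Weight four on two generators -/

section WeightFour

namespace FreeLieAlgebra

section

attribute [local instance] LieRing.ofAssociativeRing

variable {K : Type*} [Field K] {X : Type*} [DecidableEq X]

/-- A Lie polynomial of degree three contains no word of length four. -/
theorem wordCoeff_four_lie_lie (w : List X) (a b c : X) :
    wordCoeff K 4 w ⁅⁅of K a, of K b⁆, of K c⁆ = 0 := by
  have h : ∀ a b c : X, (wordMatrix K 4 w a * wordMatrix K 4 w b * wordMatrix K 4 w c) 0
      (Fin.last 4) = 0 := by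
    intro a b c
    simp only [Matrix.mul_apply, Fin.sum_univ_succ, wordMatrix]
    simp
  simp only [wordCoeff_apply, wordRep, LieHom.map_lie, lift_of_apply,
    LieRing.of_associative_ring_bracket, sub_mul, mul_sub, Matrix.sub_apply, ← mul_assoc, h,
    sub_self]

theorem wordCoeff_four_lie_lie_lie (w : List X) (a b c e : X) :
    wordCoeff K 4 w ⁅of K e, ⁅⁅of K a, of K b⁆, of K c⁆⁆ =
      (if w[0]? = some e ∧ w[1]? = some a ∧ w[2]? = some b ∧ w[3]? = some c then 1 else 0) -
      (if w[0]? = some e ∧ w[1]? = some b ∧ w[2]? = some a ∧ w[3]? = some c then 1 else 0) -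
      (if w[0]? = some e ∧ w[1]? = some c ∧ w[2]? = some a ∧ w[3]? = some b then 1 else 0) +
      (if w[0]? = some e ∧ w[1]? = some c ∧ w[2]? = some b ∧ w[3]? = some a then 1 else 0) -
      (if w[0]? = some a ∧ w[1]? = some b ∧ w[2]? = some c ∧ w[3]? = some e then 1 else 0) +
      (if w[0]? = some b ∧ w[1]? = some a ∧ w[2]? = some c ∧ w[3]? = some e then 1 else 0) +
      (if w[0]? = some c ∧ w[1]? = some a ∧ w[2]? = some b ∧ w[3]? = some e then 1 else 0) -
      (if w[0]? = some c ∧ w[1]? = some b ∧ w[2]? = some a ∧ w[3]? = some e then 1 else 0) := by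
  simp only [← wordMatrix_mul_mul_mul_apply]
  simp only [wordCoeff_apply, wordRep, LieHom.map_lie, lift_of_apply,
    LieRing.of_associative_ring_bracket, sub_mul, mul_sub, Matrix.sub_apply, ← mul_assoc]
  ring

end

variable (K : Type*) [Field K]

/-- A basis of the weight four part of the free Lie algebra on two generators. -/
noncomputable def quadCommutator : Fin 3 → FreeLieAlgebra K (Fin 2) :=
  let x : Fin 2 → FreeLieAlgebra K (Fin 2) := of K
  ![⁅x 0, ⁅⁅x 0, x 1⁆, x 0⁆⁆, ⁅x 1, ⁅⁅x 0, x 1⁆, x 0⁆⁆, ⁅x 1, ⁅⁅x 0, x 1⁆, x 1⁆⁆]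

/-- The functionals dual to `quadCommutator`. The three commutators have different multidegrees, so
one word with coefficient `±1` is chosen for each. -/
noncomputable def quadDual : Fin 3 → FreeLieAlgebra K (Fin 2) →ₗ[K] K :=
  ![-wordCoeff K 4 [0, 0, 0, 1], wordCoeff K 4 [0, 0, 1, 1], -wordCoeff K 4 [0, 1, 1, 1]]

theorem quadDual_quadCommutator (i j : Fin 3) :
    quadDual K i (quadCommutator K j) = if i = j then 1 else 0 := by
  fin_cases i <;> fin_cases j <;>
    simp [quadDual, quadCommutator, wordCoeff_four_lie_lie_lie, -lie_lie]

theorem quadDual_basicCommutator (i : Fin 3) (p : BasicTriple (Fin 2)) :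
    quadDual K i (basicCommutator K p) = 0 := by
  fin_cases i <;> simp [quadDual, basicCommutator, wordCoeff_four_lie_lie, -lie_lie]

theorem quadDual_eq_zero (i : Fin 3) {y : FreeLieAlgebra K (Fin 2)}
    (hy : y ∈ LieModule.lowerCentralSeries K (FreeLieAlgebra K (Fin 2))
      (FreeLieAlgebra K (Fin 2)) 4) : quadDual K i y = 0 := by
  fin_cases i <;> simp [quadDual, wordCoeff_eq_zero le_rfl _ hy]

theorem basicDual_eq_zero {X : Type*} [LinearOrder X] (p : BasicTriple X)
    {y : FreeLieAlgebra K X}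
    (hy : y ∈ LieModule.lowerCentralSeries K (FreeLieAlgebra K X) (FreeLieAlgebra K X) 3) :
    basicDual p y = 0 := by
  unfold basicDual
  split_ifs <;> simp [wordCoeff_eq_zero le_rfl _ hy]

theorem quadCommutator_mem (i : Fin 3) : quadCommutator K i ∈
    LieModule.lowerCentralSeries K (FreeLieAlgebra K (Fin 2)) (FreeLieAlgebra K (Fin 2)) 3 := by
  have h : ∀ x a b c : Fin 2, ⁅of K x, ⁅⁅of K a, of K b⁆, of K c⁆⁆ ∈
      LieModule.lowerCentralSeries K (FreeLieAlgebra K (Fin 2)) (FreeLieAlgebra K (Fin 2)) 3 :=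
    fun x a b c => lie_mem_lowerCentralSeries (i := 0) (j := 2) (LieSubmodule.mem_top _)
      (lie_mem_lowerCentralSeries (i := 1) (j := 0) (lie_mem_lowerCentralSeries (i := 0) (j := 0)
        (LieSubmodule.mem_top _) (LieSubmodule.mem_top _)) (LieSubmodule.mem_top _))
  fin_cases i
  · exact h 0 0 1 0
  · exact h 1 0 1 0
  · exact h 1 0 1 1

/-- With `u = [x₀, x₁]`, one has `[x₀, [u, x₁]] = [x₁, [u, x₀]]` because `[u, u] = 0`. -/
theorem lowerCentralSeries_three_le_span_sup :
    (LieModule.lowerCentralSeries K (FreeLieAlgebra K (Fin 2)) (FreeLieAlgebra K (Fin 2))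
        3).toSubmodule ≤
      Submodule.span K (Set.range (quadCommutator K)) ⊔ (LieModule.lowerCentralSeries K
        (FreeLieAlgebra K (Fin 2)) (FreeLieAlgebra K (Fin 2)) 4).toSubmodule := by
  refine lowerCentralSeries_succ_le_span_sup (k := 2) lowerCentralSeries_two_le_span_sup ?_
  rintro x _ ⟨⟨⟨i, j, k⟩, hij, hik⟩, rfl⟩
  apply Submodule.mem_sup_left
  simp only at hij hik
  obtain rfl : i = 0 := by omega
  obtain rfl : j = 1 := by omega
  have h : ∀ a b : FreeLieAlgebra K (Fin 2), ⁅a, ⁅⁅a, b⁆, b⁆⁆ = ⁅b, ⁅⁅a, b⁆, a⁆⁆ := by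
    intro a b
    rw [leibniz_lie a ⁅a, b⁆ b, lie_self, add_zero, ← lie_skew ⁅a, ⁅a, b⁆⁆ b, ← lie_skew ⁅a, b⁆ a,
      lie_neg]
  unfold basicCommutator
  fin_cases x <;> fin_cases k
  · exact Submodule.subset_span ⟨0, rfl⟩
  · exact Submodule.subset_span ⟨1, (h _ _).symm⟩
  · exact Submodule.subset_span ⟨1, rfl⟩
  · exact Submodule.subset_span ⟨2, rfl⟩

end FreeLieAlgebra

end WeightFour

/-! ### Multipliers of minimal presentations -/

section Minimal

open FreeLieAlgebra

variable {K : Type*} [Field K]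

/-- If the numerator is `F³` and the denominator is `F⁴`, the basic commutators of weight three are
a basis of the multiplier. -/
theorem NilpotentMultiplier.finrank_of_gammaBracket_eq_three {n : ℕ}
    {R : LieIdeal K (FreeLieAlgebra K (Fin n))}
    (hR : LieModule.lowerCentralSeries K (FreeLieAlgebra K (Fin n))
      (FreeLieAlgebra K (Fin n)) 2 ≤ R)
    (hγ : gammaBracket K R 2 = LieModule.lowerCentralSeries K (FreeLieAlgebra K (Fin n))
      (FreeLieAlgebra K (Fin n)) 3) :
    Module.Finite K (NilpotentMultiplier K 2 R) ∧
      Module.finrank K (NilpotentMultiplier K 2 R) = Fintype.card (BasicTriple (Fin n)) := by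
  have hA : multiplierNumerator K 2 R = _ := inf_eq_right.2 hR
  refine Submodule.finrank_subquotient_of_dual (A := (multiplierNumerator K 2 R).toSubmodule)
    (B := (gammaBracket K R 2).toSubmodule) (basicCommutator K) basicDual ?_ ?_ ?_ ?_
  · rw [hA]
    exact basicCommutator_mem
  · rw [hA, hγ]
    exact lowerCentralSeries_two_le_span_sup
  · rw [hγ]
    exact fun i x hx => basicDual_eq_zero K i hx
  · exact basicDual_basicCommutator

/-- For `F` free on two generators and `R = F³` the multiplier is `F³ / F⁵`, with the basic
commutators of weights three and four as a basis. -/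
theorem NilpotentMultiplier.finrank_lowerCentralSeries_two
    {R : LieIdeal K (FreeLieAlgebra K (Fin 2))}
    (hR : R = LieModule.lowerCentralSeries K (FreeLieAlgebra K (Fin 2))
      (FreeLieAlgebra K (Fin 2)) 2) :
    Module.Finite K (NilpotentMultiplier K 2 R) ∧
      Module.finrank K (NilpotentMultiplier K 2 R) = 5 := by
  have hA : multiplierNumerator K 2 R = _ := inf_eq_right.2 hR.ge
  have hB : gammaBracket K R 2 = _ := hR ▸ gammaBracket_lowerCentralSeries 2 2
  have hcard : Fintype.card (BasicTriple (Fin 2) ⊕ Fin 3) = 5 := by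
    have := three_mul_card_basicTriple 2
    rw [Fintype.card_sum, Fintype.card_fin]
    omega
  rw [← hcard]
  refine Submodule.finrank_subquotient_of_dual (A := (multiplierNumerator K 2 R).toSubmodule)
    (B := (gammaBracket K R 2).toSubmodule) (Sum.elim (basicCommutator K) (quadCommutator K))
    (Sum.elim basicDual (quadDual K)) ?_ ?_ ?_ ?_
  · rw [hA]
    rintro (i | i)
    · exact basicCommutator_mem i
    · exact LieModule.antitone_lowerCentralSeries K _ _ (by norm_num) (quadCommutator_mem K i)
  · rw [hA, hB, Set.Sum.elim_range, Submodule.span_union, sup_assoc]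
    exact lowerCentralSeries_two_le_span_sup.trans
      (sup_le_sup_left (lowerCentralSeries_three_le_span_sup K) _)
  · rw [hB]
    rintro (i | i) x hx
    · exact basicDual_eq_zero K i (LieModule.antitone_lowerCentralSeries K _ _ (by norm_num) hx)
    · exact quadDual_eq_zero K i hx
  · rintro (i | i) (j | j)
    · simp [basicDual_basicCommutator]
    · simp [basicDual_eq_zero K i (quadCommutator_mem K j)]
    · simp [quadDual_basicCommutator]
    · simp [quadDual_quadCommutator]

end Minimal

/-! ### Heisenberg Lie algebras -/

namespace IsHeisenberg

variable {K : Type*} [Field K] {m : ℕ} {L : Type*} [LieRing L] [LieAlgebra K L]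

theorem finite (hL : IsHeisenberg K m L) : Module.Finite K L :=
  Module.finite_of_finrank_pos (by rw [hL.finrank_eq]; omega)

theorem lie_mem_center (hL : IsHeisenberg K m L) (a b : L) : ⁅a, b⁆ ∈ LieAlgebra.center K L := by
  rw [← hL.derived_eq_center]
  exact LieSubmodule.lie_mem_lie (LieSubmodule.mem_top _) (LieSubmodule.mem_top _)

theorem finrank_center (hL : IsHeisenberg K m L) :
    Module.finrank K (LieAlgebra.center K L) = 1 := by
  rw [← hL.derived_eq_center]
  exact hL.finrank_derived

theorem exists_lie_ne_zero (hL : IsHeisenberg K m L) : ∃ a b : L, ⁅a, b⁆ ≠ 0 := by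
  by_contra! h
  have h₁ : ⁅(⊤ : LieIdeal K L), (⊤ : LieIdeal K L)⁆ = ⊥ :=
    (LieSubmodule.lie_eq_bot_iff _ _).2 fun x _ y _ => h x y
  have h₂ := hL.finrank_derived
  rw [h₁] at h₂
  exact zero_ne_one ((finrank_bot K L).symm.trans h₂)

theorem exists_eq_smul (hL : IsHeisenberg K m L) {z w : L} (hz : z ∈ LieAlgebra.center K L)
    (hz₀ : z ≠ 0) (hw : w ∈ LieAlgebra.center K L) : ∃ t : K, t • z = w := by
  obtain ⟨t, ht⟩ := (finrank_eq_one_iff_of_nonzero' (⟨z, hz⟩ : LieAlgebra.center K L)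
    (fun h => hz₀ (congrArg Subtype.val h))).1 hL.finrank_center ⟨w, hw⟩
  exact ⟨t, congrArg Subtype.val ht⟩

theorem le_finrank_ker_ad (hL : IsHeisenberg K m L) (c : L) :
    2 * m ≤ Module.finrank K (LinearMap.ker (LieAlgebra.ad K L c)) := by
  have := hL.finite
  have h₁ := LinearMap.finrank_range_add_finrank_ker (LieAlgebra.ad K L c)
  have h₂ : Module.finrank K (LinearMap.range (LieAlgebra.ad K L c)) ≤ 1 := by
    rw [← hL.finrank_center]
    apply Submodule.finrank_mono (t := (LieAlgebra.center K L).toSubmodule)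
    rintro _ ⟨y, rfl⟩
    exact hL.lie_mem_center c y
  rw [hL.finrank_eq] at h₁
  omega

/-- For `m ≥ 2` no centralizer `C` is abelian. Otherwise, for `u` outside `C`, the elements of `C`
commuting with `u` would be central, and they form a subspace of dimension at least
`2m - 1 > 1`. -/
theorem exists_lie_ne_zero_of_lie_eq_zero (hL : IsHeisenberg K m L) (hm : 2 ≤ m) (c : L) :
    ∃ a b : L, ⁅c, a⁆ = 0 ∧ ⁅c, b⁆ = 0 ∧ ⁅a, b⁆ ≠ 0 := by
  have := hL.finite
  by_contra! H
  set C := LinearMap.ker (LieAlgebra.ad K L c) with hC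
  have memC : ∀ {a : L}, a ∈ C ↔ ⁅c, a⁆ = 0 := by simp [hC]
  have hCdim : 2 * m ≤ Module.finrank K C := hL.le_finrank_ker_ad c
  obtain ⟨u, hu⟩ : ∃ u, u ∉ C := by
    by_contra! h
    obtain ⟨a, b, hab⟩ := hL.exists_lie_ne_zero
    exact hab (H a b (memC.1 (h a)) (memC.1 (h b)))
  have htop : C ⊔ Submodule.span K {u} = ⊤ := by
    apply Submodule.eq_top_of_finrank_eq
    have h₁ : C < C ⊔ Submodule.span K {u} := left_lt_sup.2 fun h =>
      hu (h (Submodule.mem_span_singleton_self u))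
    have h₂ := Submodule.finrank_lt_finrank_of_lt h₁
    have h₃ := Submodule.finrank_le (C ⊔ Submodule.span K {u})
    rw [hL.finrank_eq] at h₃ ⊢
    omega
  set U := LinearMap.ker (LieAlgebra.ad K L u) with hU
  have hUdim : 2 * m ≤ Module.finrank K U := hL.le_finrank_ker_ad u
  have hle : C ⊓ U ≤ (LieAlgebra.center K L).toSubmodule := by
    rintro d ⟨hdC, hdU⟩
    rw [LieSubmodule.mem_toSubmodule, LieModule.mem_maxTrivSubmodule]
    intro y
    obtain ⟨a, ha, v, hv, rfl⟩ := Submodule.mem_sup.1 (htop ▸ Submodule.mem_top : y ∈ _)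
    obtain ⟨t, rfl⟩ := Submodule.mem_span_singleton.1 hv
    have hdU' : ⁅u, d⁆ = 0 := hdU
    rw [add_lie, smul_lie, hdU', H a d (memC.1 ha) (memC.1 hdC), smul_zero, add_zero]
  have h₁ := Submodule.finrank_mono hle
  have h₂ := Submodule.finrank_sup_add_finrank_inf_eq C U
  have h₃ := Submodule.finrank_le (C ⊔ U)
  have h₄ : Module.finrank K (LieAlgebra.center K L).toSubmodule = 1 := hL.finrank_center
  rw [hL.finrank_eq] at h₃
  omega

section Presentation

variable {F : Type*} [LieRing F] [LieAlgebra K F] {π : F →ₗ⁅K⁆ L}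

theorem map_mem_center (hL : IsHeisenberg K m L) {y : F}
    (hy : y ∈ LieModule.lowerCentralSeries K F F 1) : π y ∈ LieAlgebra.center K L := by
  rw [← hL.derived_eq_center]
  exact π.map_mem_lowerCentralSeries 1 hy

theorem lowerCentralSeries_two_le_ker (hL : IsHeisenberg K m L) :
    LieModule.lowerCentralSeries K F F 2 ≤ π.ker := by
  rw [LieModule.lowerCentralSeries_succ, LieSubmodule.lie_le_iff]
  intro x _ y hy
  rw [LieHom.mem_ker, LieHom.map_lie]
  exact (LieModule.mem_maxTrivSubmodule K L L _).1 (hL.map_mem_center hy) _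

/-- For `m ≥ 2` one has `F³ ≤ [R, F]`: given `c`, the space `F²` is spanned modulo `R` by a bracket
`[a, b]` with `[c, a]` and `[c, b]` in `R`, and the Jacobi identity puts `[c, [a, b]]` in
`[R, F]`. -/
theorem lowerCentralSeries_two_le_gammaBracket (hL : IsHeisenberg K m L) (hm : 2 ≤ m)
    (hπ : Function.Surjective π) :
    LieModule.lowerCentralSeries K F F 2 ≤ gammaBracket K π.ker 1 := by
  rw [LieModule.lowerCentralSeries_succ, LieSubmodule.lie_le_iff]
  intro c _ z hz
  obtain ⟨a', b', ha, hb, hab⟩ := hL.exists_lie_ne_zero_of_lie_eq_zero hm (π c)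
  obtain ⟨a, rfl⟩ := hπ a'
  obtain ⟨b, rfl⟩ := hπ b'
  obtain ⟨t, ht⟩ := hL.exists_eq_smul (hL.lie_mem_center _ _) hab (hL.map_mem_center (π := π) hz)
  have hr : z - t • ⁅a, b⁆ ∈ gammaBracket K π.ker 0 := by
    change _ ∈ π.ker
    simp [LieHom.mem_ker, ht]
  have hca : ⁅c, a⁆ ∈ gammaBracket K π.ker 0 := by
    change _ ∈ π.ker
    rw [LieHom.mem_ker, LieHom.map_lie, ha]
  have hcb : ⁅c, b⁆ ∈ gammaBracket K π.ker 0 := by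
    change _ ∈ π.ker
    rw [LieHom.mem_ker, LieHom.map_lie, hb]
  have e : ⁅c, z⁆ = ⁅c, z - t • ⁅a, b⁆⁆ + t • (⁅⁅c, a⁆, b⁆ + ⁅a, ⁅c, b⁆⁆) := by
    rw [← leibniz_lie, lie_sub, lie_smul, sub_add_cancel]
  rw [e]
  exact add_mem (lie_mem_gammaBracket_succ' hr _) ((gammaBracket K π.ker 1).smul_mem t
    (add_mem (lie_mem_gammaBracket_succ hca _) (lie_mem_gammaBracket_succ' hcb _)))

end Presentation

/-- A Heisenberg algebra has a minimal presentation, whose generators lift a basis of `L / Z(L)`. -/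
theorem exists_minimal_presentation (hL : IsHeisenberg K m L) :
    ∃ ρ : FreeLieAlgebra K (Fin (2 * m)) →ₗ⁅K⁆ L, Function.Surjective ρ ∧
      ρ.ker ≤ LieModule.lowerCentralSeries K (FreeLieAlgebra K (Fin (2 * m)))
        (FreeLieAlgebra K (Fin (2 * m))) 1 := by
  have := hL.finite
  set Z := (LieAlgebra.center K L).toSubmodule with hZ
  have hdim : Module.finrank K (L ⧸ Z) = 2 * m := by
    have h₁ := Submodule.finrank_quotient_add_finrank Z
    have h₂ : Module.finrank K Z = 1 := hL.finrank_center
    rw [hL.finrank_eq] at h₁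
    omega
  let v := Module.finBasisOfFinrankEq K (L ⧸ Z) hdim
  choose s hs using fun i => Z.mkQ_surjective (v i)
  let ρ := FreeLieAlgebra.lift K s
  have hρ : ∀ c : Fin (2 * m) → K,
      Z.mkQ (ρ (∑ i, c i • FreeLieAlgebra.of K i)) = ∑ i, c i • v i := by
    intro c
    have : ρ (∑ i, c i • FreeLieAlgebra.of K i) = ∑ i, c i • s i := by
      rw [← LieHom.coe_toLinearMap, map_sum]
      simp [ρ]
    rw [this, map_sum]
    simp only [map_smul, hs]
  have hmod : ∀ a, ∃ y, a - ρ y ∈ Z := by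
    intro a
    refine ⟨∑ i, v.repr (Z.mkQ a) i • FreeLieAlgebra.of K i, ?_⟩
    rw [← Submodule.Quotient.mk_eq_zero, ← Submodule.mkQ_apply, map_sub, hρ, v.sum_repr, sub_self]
  refine ⟨ρ, fun a => ?_, fun y hy => ?_⟩
  · -- The range contains `[L, L]`, since brackets only depend on classes modulo the centre.
    have hZρ : Z ≤ ρ.range.toSubmodule := by
      rw [hZ, ← hL.derived_eq_center, LieSubmodule.lieIdeal_oper_eq_linear_span', Submodule.span_le]
      rintro _ ⟨a, -, b, -, rfl⟩
      obtain ⟨y, hy⟩ := hmod a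
      obtain ⟨z, hz⟩ := hmod b
      refine ⟨⁅y, z⁆, ?_⟩
      have h₁ : ⁅ρ y, b - ρ z⁆ = 0 := (LieModule.mem_maxTrivSubmodule K L L _).1 hz _
      have h₂ : ⁅b, a - ρ y⁆ = 0 := (LieModule.mem_maxTrivSubmodule K L L _).1 hy _
      rw [lie_sub, sub_eq_zero] at h₁ h₂
      change ρ ⁅y, z⁆ = ⁅a, b⁆
      rw [LieHom.map_lie, ← h₁, ← lie_skew a b, h₂, lie_skew]
    obtain ⟨y, hy⟩ := hmod a
    obtain ⟨z, hz⟩ := hZρ hy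
    have hz' : ρ z = a - ρ y := hz
    exact ⟨z + y, by rw [map_add, hz', sub_add_cancel]⟩
  · obtain ⟨u, hu, y', hy', rfl⟩ :=
      Submodule.mem_sup.1 (FreeLieAlgebra.mem_span_of_sup_derived y)
    obtain ⟨c, rfl⟩ := (Submodule.mem_span_range_iff_exists_fun K).1 hu
    have h₁ : Z.mkQ (ρ (∑ i, c i • FreeLieAlgebra.of K i)) = 0 := by
      rw [LieHom.mem_ker, map_add] at hy
      rw [eq_neg_of_add_eq_zero_left hy, ← LinearMap.mem_ker, Submodule.ker_mkQ]
      exact neg_mem (hL.map_mem_center hy')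
    rw [hρ] at h₁
    have h₂ := Fintype.linearIndependent_iff.1 v.linearIndependent c h₁
    simpa [h₂] using hy'

/-- For `m = 1` the relations of a minimal presentation are exactly `F³`: the space `F² / F³` is
spanned by `[x₀, x₁]`, whose image in `L` is nonzero. -/
theorem ker_eq_lowerCentralSeries_two (hL : IsHeisenberg K m L)
    {ρ : FreeLieAlgebra K (Fin 2) →ₗ⁅K⁆ L} (hρ : Function.Surjective ρ)
    (hker : ρ.ker ≤ LieModule.lowerCentralSeries K (FreeLieAlgebra K (Fin 2))
      (FreeLieAlgebra K (Fin 2)) 1) :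
    ρ.ker = LieModule.lowerCentralSeries K (FreeLieAlgebra K (Fin 2))
      (FreeLieAlgebra K (Fin 2)) 2 := by
  have hset : {t : FreeLieAlgebra K (Fin 2) | ∃ i j : Fin 2, i < j ∧
      t = ⁅FreeLieAlgebra.of K i, FreeLieAlgebra.of K j⁆} =
      {⁅FreeLieAlgebra.of K (0 : Fin 2), FreeLieAlgebra.of K (1 : Fin 2)⁆} := by
    ext t
    constructor
    · rintro ⟨i, j, hij, rfl⟩
      obtain rfl : i = 0 := by omega
      obtain rfl : j = 1 := by omega
      rfl
    · rintro rfl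
      exact ⟨0, 1, by decide, rfl⟩
  have hspan := FreeLieAlgebra.derived_le_span_sup (K := K) (X := Fin 2)
  rw [hset] at hspan
  refine le_antisymm (fun y hy => ?_) hL.lowerCentralSeries_two_le_ker
  obtain ⟨u, hu, y', hy', rfl⟩ := Submodule.mem_sup.1 (hspan (hker hy))
  obtain ⟨t, rfl⟩ := Submodule.mem_span_singleton.1 hu
  by_cases ht : t = 0
  · simpa [ht] using hy'
  exfalso
  have h₁ : ⁅FreeLieAlgebra.of K (0 : Fin 2), FreeLieAlgebra.of K (1 : Fin 2)⁆ ∈ ρ.ker := by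
    have := sub_mem hy (hL.lowerCentralSeries_two_le_ker hy')
    rw [add_sub_cancel_right] at this
    exact (Submodule.smul_mem_iff ρ.ker.toSubmodule ht).1 this
  have h₂ : (LieModule.lowerCentralSeries K (FreeLieAlgebra K (Fin 2))
      (FreeLieAlgebra K (Fin 2)) 1).toSubmodule ≤ ρ.ker.toSubmodule := by
    refine hspan.trans (sup_le ?_ hL.lowerCentralSeries_two_le_ker)
    rw [Submodule.span_singleton_le_iff_mem]
    exact h₁
  obtain ⟨a, b, hab⟩ := hL.exists_lie_ne_zero
  obtain ⟨x, rfl⟩ := hρ a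
  obtain ⟨y, rfl⟩ := hρ b
  have h₃ : ⁅x, y⁆ ∈ ρ.ker := h₂ (lie_mem_lowerCentralSeries (i := 0) (j := 0)
    (LieSubmodule.mem_top x) (LieSubmodule.mem_top y))
  rw [LieHom.mem_ker, LieHom.map_lie] at h₃
  exact hab h₃

/-- For `m ≥ 2` and a minimal presentation, `[[R, F], F] = F⁴`. -/
theorem gammaBracket_two_eq (hL : IsHeisenberg K m L) (hm : 2 ≤ m) {F : Type*} [LieRing F]
    [LieAlgebra K F] {ρ : F →ₗ⁅K⁆ L} (hρ : Function.Surjective ρ)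
    (hker : ρ.ker ≤ LieModule.lowerCentralSeries K F F 1) :
    gammaBracket K ρ.ker 2 = LieModule.lowerCentralSeries K F F 3 := by
  apply le_antisymm
  · rw [← gammaBracket_lowerCentralSeries 1 2]
    exact gammaBracket_mono hker 2
  · rw [LieModule.lowerCentralSeries_succ, LieSubmodule.lie_comm]
    exact LieSubmodule.mono_lie_left _ (hL.lowerCentralSeries_two_le_gammaBracket hm hρ)

end IsHeisenberg

theorem mainTheorem1 {K : Type*} [Field K] {L : Type*} [LieRing L] [LieAlgebra K L]
    (m : ℕ) (hL : IsHeisenberg K m L)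
    {X : Type*} (π : FreeLieAlgebra K X →ₗ⁅K⁆ L) (hπ : Function.Surjective π) :
    (m = 1 →
      IsLieAbelian (NilpotentMultiplier K 2 π.ker) ∧
      Module.Finite K (NilpotentMultiplier K 2 π.ker) ∧
      Module.finrank K (NilpotentMultiplier K 2 π.ker) = 5) ∧
    (2 ≤ m →
      IsLieAbelian (NilpotentMultiplier K 2 π.ker) ∧
      Module.Finite K (NilpotentMultiplier K 2 π.ker) ∧
      (Module.finrank K (NilpotentMultiplier K 2 π.ker) : ℚ) = (8 * (m : ℚ) ^ 3 - 2 * m) / 3) := by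
  have hab := NilpotentMultiplier.isLieAbelian 2 π.ker
  obtain ⟨ρ, hρ, hker⟩ := hL.exists_minimal_presentation
  obtain ⟨e⟩ := NilpotentMultiplier.nonempty_equiv 2 π hπ ρ hρ
  constructor
  · rintro rfl
    obtain ⟨h₁, h₂⟩ := NilpotentMultiplier.finrank_lowerCentralSeries_two
      (hL.ker_eq_lowerCentralSeries_two hρ hker)
    exact ⟨hab, Module.Finite.equiv e.symm, e.finrank_eq.trans h₂⟩
  · intro hm
    obtain ⟨h₁, h₂⟩ := NilpotentMultiplier.finrank_of_gammaBracket_eq_three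
      hL.lowerCentralSeries_two_le_ker (hL.gammaBracket_two_eq hm hρ hker)
    refine ⟨hab, Module.Finite.equiv e.symm, ?_⟩
    rw [e.finrank_eq, h₂]
    have h₃ : (3 * Fintype.card (FreeLieAlgebra.BasicTriple (Fin (2 * m))) + 2 * m : ℚ) =
        (2 * m) ^ 3 := mod_cast three_mul_card_basicTriple (2 * m)
    linear_combination h₃ / 3
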